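/- Consider a cache-enabled fog radio access network in the plane $\mathbb{R}^2$ with a typical user at the origin. There are three tiers of base stations: F-APs holding the requested content ($F_c$), F-APs not holding it ($\tilde F_c$), and RRHs ($R$). They form independent homogeneous Poisson point processes $\Phi_{F_c},\Phi_{\tilde F_c},\Phi_R$ with densities $\lambda_{F_c}=p_{hit}\lambda_F$, $\lambda_{\tilde F_c}=(1-p_{hit})\lambda_F$ and $\lambda_R$, where $\lambda_F,\lambda_R>0$ and $p_{hit}=\sum_{i=1}^{M} i^{-\tau}/\sum_{j=1}^{N} j^{-\tau}$ with $\tau\ge 0$ and $1\le M<N$. The transmit powers are $P_{F_c}=P_{\tilde F_c}=P_F>0$ and $P_R>0$, the path loss exponent is $\alpha>2$, the noise variance is $\sigma^2\ge 0$, and the channel gains $|h_x|^2$ are i.i.d. exponential with mean $1$ and independent of the positions. Let $B\ge 0$ and $N_B\ge 2$ be integers (number of feedback bits, number of RRH antennas), let $\zeta=1-2^B\beta\big(2^B,\tfrac{N_B}{N_B-1}\big)$ with $\beta$ the Beta function, and let $\upsilon=2^{-B/(N_B-1)}$. With $r_x$ the distance from $x$ to the origin, write $\Phi_F=\Phi_{F_c}\cup\Phi_{\tilde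 F_c}$ and $W_x=P_F|h_x|^2r_x^{-\alpha}$ for $x\in\Phi_F$, $W_x=P_R|h_x|^2r_x^{-\alpha}$ for $x\in\Phi_R$. The SINR of the user at $x$ is $$\gamma_x=\frac{W_x}{\sum_{z\in\Phi_F\setminus\{x\}}W_z+\sum_{y\in\Phi_R}W_y+\sigma^2}\quad(x\in\Phi_F),\qquad \gamma_x=\frac{\zeta W_x}{\sum_{z\in\Phi_F}W_z+\upsilon\sum_{y\in\Phi_R\setminus\{x\}}W_y+\sigma^2}\quad(x\in\Phi_R).$$ For thresholds $\eta_i$, $i\in\{F_c,\tilde F_c,R\}$, let $$S(\{\eta_i\},\alpha)=\mathbb{P}\Big(\bigcup_{i}\bigcup_{x\in\Phi_i}\{\gamma_x>\eta_i\}\Big)$$ be the success probability of the minimal-delay association policy, and let $S(\eta,\alpha)$ be its value when all $\eta_i=\eta$. Then almost surely $\gamma_x$ attains a finite maximum over all base stations, and the average ergodic rate of the minimal-delay policy satisfies, as an identity in $[0,\infty]$, $$R(\alpha)=\mathbb{E}\Big[\log_2\big(1+\max_{x}\gamma_x\big)\Big]=\int_0^\infty \mathbb{P}\Big[\max_x\gamma_x\ge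 2^t-1\Big]\,dt=\int_0^\infty S(2^t-1,\alpha)\,dt .$$ -/

import Mathlib

open MeasureTheory ProbabilityTheory Set
open scoped ENNReal

namespace FRAN

noncomputable section

/-- The plane in which the base stations are deployed; the typical user sits at the origin. -/
abbrev Plane : Type := EuclideanSpace ℝ (Fin 2)

/-- The three classes of base stations: F-APs with the requested content, F-APs without it, and
RRHs. -/
inductive Tier : Type
  | cached
  | uncached
  | rrh

/-- A base station: its tier together with its number in the enumeration of that tier. -/
abbrev BS : Type := Tier × ℕ

/-- The Zipf popularity `f_i(τ, N) = i^{-τ} / ∑_{j=1}^N j^{-τ}` of the `i`-th most popular of `N`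
contents. -/
def zipf (τ : ℝ) (N i : ℕ) : ℝ :=
  (1 / (i : ℝ) ^ τ) / ∑ j ∈ Finset.Icc 1 N, 1 / (j : ℝ) ^ τ

/-- The parameters of a cache-enabled fog radio access network, with their standing ranges. -/
structure Params where
  /-- density of the F-APs -/
  lamF : ℝ
  /-- density of the RRHs -/
  lamR : ℝ
  /-- transmit power of the F-APs -/
  powF : ℝ
  /-- transmit power of the RRHs -/
  powR : ℝ
  /-- path loss exponent -/
  α : ℝ
  /-- noise variance `σ²` (the value `0` is the interference-limited network) -/
  noise : ℝ
  /-- Zipf exponent -/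
  τ : ℝ
  /-- number of contents in the database -/
  N : ℕ
  /-- number of contents cached at each F-AP -/
  M : ℕ
  /-- number of feedback bits -/
  B : ℕ
  /-- number of antennas at each RRH -/
  NB : ℕ
  lamF_pos : 0 < lamF
  lamR_pos : 0 < lamR
  powF_pos : 0 < powF
  powR_pos : 0 < powR
  two_lt_α : 2 < α
  noise_nonneg : 0 ≤ noise
  τ_nonneg : 0 ≤ τ
  one_le_M : 1 ≤ M
  M_lt_N : M < N
  two_le_NB : 2 ≤ NB

namespace Params

variable (p : Params)

/-- The caching hit probability when the `M` most popular contents are cached. -/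
def hitProb : ℝ := ∑ i ∈ Finset.Icc 1 p.M, zipf p.τ p.N i

/-- The density of each tier. -/
def density : Tier → ℝ
  | .cached => p.hitProb * p.lamF
  | .uncached => (1 - p.hitProb) * p.lamF
  | .rrh => p.lamR

/-- The transmit power in each tier. -/
def txPower : Tier → ℝ
  | .cached => p.powF
  | .uncached => p.powF
  | .rrh => p.powR

/-- The quantized coefficient `ζ = 1 - L β(L, N_B / (N_B - 1))`, with codebook size `L = 2^B`. -/
def ζ : ℝ :=
  1 - (2 : ℝ) ^ p.B * ProbabilityTheory.beta ((2 : ℝ) ^ p.B) ((p.NB : ℝ) / ((p.NB : ℝ) - 1))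

/-- The residual interference coefficient `υ = 2^{-B / (N_B - 1)}`. -/
def υ : ℝ := (2 : ℝ) ^ (-((p.B : ℝ) / ((p.NB : ℝ) - 1)))

/-- The factor multiplying the received power of a serving base station: `ζ` for an RRH, `1` for
an F-AP. -/
def signalGain : Tier → ℝ
  | .rrh => p.ζ
  | _ => 1

/-- The factor multiplying the received power of an interfering base station of the second tier
when the user is served by the first tier: `υ` between two RRHs, `1` otherwise. -/
def coupling : Tier → Tier → ℝ
  | .rrh, .rrh => p.υ
  | _, _ => 1

end Params

/-- The random points `X 0, X 1, …` enumerate a Poisson point process with intensity measure `ν`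
on the plane: for pairwise disjoint bounded Borel sets, the numbers of points in them are
independent and have the Poisson laws with means the `ν`-measures of the sets. -/
structure IsPoissonProcess {Ω : Type*} [MeasurableSpace Ω] (X : ℕ → Ω → Plane) (ν : Measure Plane)
    (P : Measure Ω) : Prop where
  measurable : ∀ n, Measurable (X n)
  law : ∀ (m : ℕ) (A : Fin m → Set Plane) (k : Fin m → ℕ),
    (∀ j, MeasurableSet (A j)) → (∀ j, Bornology.IsBounded (A j)) →
    Pairwise (fun i j => Disjoint (A i) (A j)) →
    P {ω | ∀ j, {n | X n ω ∈ A j}.encard = (k j : ℕ∞)} =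
      ∏ j, poissonMeasure (ν (A j)).toNNReal {k j}

/-- The random network: in each tier the base stations (at positions `X i n`) form a homogeneous
Poisson point process with the density of the tier, the three processes are independent, and the
channel gains `g i n = |h|²` are i.i.d. exponential with mean `1`, independent of the positions. -/
structure IsNetwork (p : Params) {Ω : Type*} [MeasurableSpace Ω] (X : Tier → ℕ → Ω → Plane)
    (g : Tier → ℕ → Ω → ℝ) (P : Measure Ω) : Prop where
  poisson : ∀ i, IsPoissonProcess (X i) (ENNReal.ofReal (p.density i) • volume) P
  indep_tiers : iIndepFun (fun (i : Tier) (ω : Ω) (n : ℕ) => X i n ω) P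
  gain_measurable : ∀ i n, Measurable (g i n)
  gain_law : ∀ i n, P.map (g i n) = expMeasure 1
  indep_gains : iIndepFun (fun (b : BS) (ω : Ω) => g b.1 b.2 ω) P
  indep_gains_positions :
    IndepFun (fun ω (i : Tier) (n : ℕ) => X i n ω) (fun ω (i : Tier) (n : ℕ) => g i n ω) P

section SINR

variable (p : Params) {Ω : Type*} (X : Tier → ℕ → Ω → Plane) (g : Tier → ℕ → Ω → ℝ)

/-- The received power `P_i |h|² r^{-α}` at the origin from the base station `b`, in `[0, ∞]`. -/
def rxPower (b : BS) (ω : Ω) : ℝ≥0∞ :=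
  ENNReal.ofReal (p.txPower b.1 * g b.1 b.2 ω) * ‖X b.1 b.2 ω‖ₑ ^ (-p.α)

/-- The SINR `γ_s` of the typical user when it is served by the base station `s`:
`P_F |h_s|² r_s^{-α} / (∑_{other F-APs} P_F |h|² r^{-α} + ∑_{RRHs} P_R |h|² r^{-α} + σ²)` if `s` is
an F-AP, and
`ζ P_R |h_s|² r_s^{-α} / (∑_{F-APs} P_F |h|² r^{-α} + υ ∑_{other RRHs} P_R |h|² r^{-α} + σ²)`
if `s` is an RRH. -/
def sinr (s : BS) (ω : Ω) : ℝ≥0∞ :=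
  ENNReal.ofReal (p.signalGain s.1) * rxPower p X g s ω /
    ((∑' b : {b : BS // b ≠ s}, ENNReal.ofReal (p.coupling s.1 b.1.1) * rxPower p X g b.1 ω) +
      ENNReal.ofReal p.noise)

/-- The supremum of the SINR over all base stations (almost surely a maximum). -/
def maxSinr (ω : Ω) : ℝ≥0∞ := ⨆ s : BS, sinr p X g s ω

/-- The success probability `S({η_i}, α)` of the minimal-delay policy: the probability that some
base station has an SINR exceeding the threshold of its tier. -/
def successProb [MeasurableSpace Ω] (P : Measure Ω) (η : Tier → ℝ) : ℝ≥0∞ :=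
  P {ω | ∃ s : BS, ENNReal.ofReal (η s.1) < sinr p X g s ω}

/-- `log₂ (1 + x)` for `x ∈ [0, ∞]`. -/
def log2OneAdd (x : ℝ≥0∞) : ℝ≥0∞ :=
  (ENNReal.log (1 + x)).toENNReal / ENNReal.ofReal (Real.log 2)

/-- The average ergodic rate `E[log₂ (1 + max_x γ_x)]`, as an expectation in `[0, ∞]`. -/
def ergodicRate [MeasurableSpace Ω] (P : Measure Ω) : ℝ≥0∞ :=
  ∫⁻ ω, log2OneAdd (maxSinr p X g ω) ∂P

end SINR

end

end FRAN

namespace FRAN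

/-! Almost surely every gain is positive and no station sits at the origin, so every received power
lies in `(0, ∞)`; the rest of the maximum claim is deterministic (`iSup_sinr_lt_top_and_attained`).
If the total power is infinite, so is the interference at every station, and all SINRs vanish. If it
is finite, the powers tend to `0` along the cofinite filter while the denominators stay bounded
below, so the SINRs tend to `0` and attain their supremum. Convergence of the interference is thus
never needed. Both rate formulas are the layer-cake formula for `log₂ (1 + max γ)`: the non-strict
form gives the tail of the maximum, the strict one gives `S`. -/

/-- A function into `[0, ∞]` tending to `0` along the cofinite filter attains its supremum. -/
theorem exists_eq_iSup_of_tendsto_cofinite_zero {ι : Type*} [Nonempty ι] {f : ι → ℝ≥0∞}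
    (hf : Filter.Tendsto f Filter.cofinite (nhds 0)) : ∃ s, f s = ⨆ i, f i := by
  by_cases h0 : ∀ i, f i = 0
  · exact ⟨Classical.arbitrary ι, by simp [h0]⟩
  push Not at h0
  obtain ⟨i₀, hi₀⟩ := h0
  -- Only finitely many values reach the positive level `f i₀`; the largest of them is the global
  -- maximum.
  have hfin : {i | f i₀ ≤ f i}.Finite := by
    simpa [Filter.eventually_cofinite] using
      hf.eventually (gt_mem_nhds (pos_iff_ne_zero.mpr hi₀))
  obtain ⟨s, hs, hmax⟩ := hfin.exists_maximalFor f _ ⟨i₀, le_refl (f i₀)⟩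
  refine ⟨s, le_antisymm (le_iSup f s) (iSup_le fun i => ?_)⟩
  rcases le_total (f i) (f s) with h | h
  · exact h
  · exact hmax (le_trans hs h) h

/-- The signal-to-interference-plus-noise ratios of infinitely many transmitters with finite
positive received powers attain a finite maximum, if the gains are bounded and the couplings are
bounded below. -/
theorem iSup_sinr_lt_top_and_attained {ι : Type*} [Infinite ι] {W a : ι → ℝ≥0∞}
    {k : ι → ι → ℝ≥0∞} {n A c : ℝ≥0∞} (hW0 : ∀ i, W i ≠ 0) (hWtop : ∀ i, W i ≠ ∞)
    (ha : ∀ i, a i ≤ A) (hA : A ≠ ∞) (hc : c ≠ 0) (hk : ∀ i j, c ≤ k i j) :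
    (⨆ s, a s * W s / ((∑' b : {b // b ≠ s}, k s b.1 * W b.1) + n)) < ∞ ∧
      ∃ s, a s * W s / ((∑' b : {b // b ≠ s}, k s b.1 * W b.1) + n) =
        ⨆ s, a s * W s / ((∑' b : {b // b ≠ s}, k s b.1 * W b.1) + n) := by
  set γ : ι → ℝ≥0∞ := fun s => a s * W s / ((∑' b : {b // b ≠ s}, k s b.1 * W b.1) + n) with hγ
  have hlow : ∀ s, c * ∑' b : {b // b ≠ s}, W b.1 ≤
      (∑' b : {b // b ≠ s}, k s b.1 * W b.1) + n := fun s => by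
    rw [← ENNReal.tsum_mul_left]
    exact (ENNReal.tsum_le_tsum fun b => mul_le_mul_left (hk s b.1) _).trans le_self_add
  suffices h : (∀ s, γ s ≠ ∞) ∧ Filter.Tendsto γ Filter.cofinite (nhds 0) by
    obtain ⟨s, hs⟩ := exists_eq_iSup_of_tendsto_cofinite_zero h.2
    exact ⟨hs ▸ (h.1 s).lt_top, s, hs⟩
  by_cases hT : ∑' i, W i = ∞
  · have hzero : ∀ s, γ s = 0 := fun s => by
      have hsplit := ENNReal.summable.tsum_add_tsum_compl (f := W) (s := {s}) ENNReal.summable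
      rw [hT, tsum_singleton s W, ENNReal.add_eq_top] at hsplit
      have hrest : ∑' b : {b // b ≠ s}, W b.1 = ∞ := hsplit.resolve_left (hWtop s)
      have hden := hlow s
      rw [hrest, ENNReal.mul_top hc, top_le_iff] at hden
      simp only [hγ, hden, ENNReal.div_top]
    rw [show γ = fun _ => 0 from funext hzero]
    exact ⟨fun _ => ENNReal.zero_ne_top, tendsto_const_nhds⟩
  -- Whichever `s` serves, `u` or `v` interferes, which bounds the denominator below uniformly in
  -- `s`, even when `n = 0`.
  · obtain ⟨u, v, huv⟩ := exists_pair_ne ι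
    have hm : c * min (W u) (W v) ≠ 0 := mul_ne_zero hc (by simp [min_eq_iff, hW0])
    have hden : ∀ s, c * min (W u) (W v) ≤ (∑' b : {b // b ≠ s}, k s b.1 * W b.1) + n := by
      intro s
      refine le_trans (mul_le_mul_right ?_ _) (hlow s)
      by_cases hs : u = s
      · exact (min_le_right _ _).trans
          (ENNReal.le_tsum (f := fun b : {b // b ≠ s} => W b.1) ⟨v, fun h => huv (hs.trans h.symm)⟩)
      · exact (min_le_left _ _).trans
          (ENNReal.le_tsum (f := fun b : {b // b ≠ s} => W b.1) ⟨u, hs⟩)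
    have hbound : ∀ s, γ s ≤ A / (c * min (W u) (W v)) * W s := fun s => by
      rw [← ENNReal.mul_div_right_comm]
      exact ENNReal.div_le_div (mul_le_mul_left (ha s) _) (hden s)
    have hAm : A / (c * min (W u) (W v)) ≠ ∞ := ENNReal.div_ne_top hA hm
    refine ⟨fun s => ne_top_of_le_ne_top (ENNReal.mul_ne_top hAm (hWtop s)) (hbound s), ?_⟩
    refine tendsto_of_tendsto_of_tendsto_of_le_of_le tendsto_const_nhds ?_
      (fun _ => zero_le) hbound
    simpa using ENNReal.Tendsto.const_mul (ENNReal.tendsto_cofinite_zero_of_tsum_ne_top hT)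
      (Or.inr hAm)

namespace Params

variable (p : Params)

theorem txPower_pos (i : Tier) : 0 < p.txPower i := by
  cases i
  exacts [p.powF_pos, p.powF_pos, p.powR_pos]

theorem υ_pos : 0 < p.υ := Real.rpow_pos_of_pos two_pos _

/-- A crude bound suffices, so the Beta function in `ζ` need not be estimated. -/
theorem signalGain_le (i : Tier) : p.signalGain i ≤ max p.ζ 1 := by
  cases i
  exacts [le_max_right _ _, le_max_right _ _, le_max_left _ _]

theorem le_coupling (i j : Tier) : min p.υ 1 ≤ p.coupling i j := by
  cases i <;> cases j <;> simp [coupling]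

end Params

/-- Almost surely a Poisson process has no point at a given non-atom of its intensity measure. -/
theorem IsPoissonProcess.ae_ne {Ω : Type*} [MeasurableSpace Ω] {P : Measure Ω}
    [IsProbabilityMeasure P] {X : ℕ → Ω → Plane} {ν : Measure Plane}
    (h : IsPoissonProcess X ν P) {x : Plane} (hx : ν {x} = 0) :
    ∀ᵐ ω ∂P, ∀ n, X n ω ≠ x := by
  have hmeas : MeasurableSet {ω | ∀ n, X n ω ≠ x} := by
    rw [ofPred_forall]
    exact MeasurableSet.iInter fun n => (h.measurable n (measurableSet_singleton x)).compl
  refine (mem_ae_iff_prob_eq_one hmeas).2 ?_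
  -- A Poisson count of mean `0` is `0` with probability one.
  have hlaw := h.law 1 (fun _ => {x}) (fun _ => 0) (fun _ => measurableSet_singleton x)
    (fun _ => Bornology.isBounded_singleton) (fun i j hij => (hij (Subsingleton.elim i j)).elim)
  simpa [hx, poissonMeasure_singleton, Set.eq_empty_iff_forall_notMem] using hlaw

theorem expMeasure_Iic_zero (r : ℝ) : expMeasure r (Iic 0) = 0 := by
  -- The density vanishes only on the open half-line; the endpoint is a null set.
  rw [expMeasure, gammaMeasure, withDensity_apply _ measurableSet_Iic,
    setLIntegral_congr Iio_ae_eq_Iic.symm]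
  exact lintegral_gammaPDF_of_nonpos le_rfl

section Network

variable {p : Params} {Ω : Type*} [MeasurableSpace Ω] {P : Measure Ω}
  {X : Tier → ℕ → Ω → Plane} {g : Tier → ℕ → Ω → ℝ}

instance : Countable Tier :=
  Function.Injective.countable (f := fun i : Tier => i.ctorIdx) fun i j => by
    cases i <;> cases j <;> simp [Tier.ctorIdx]

instance : Nonempty Tier := ⟨.cached⟩

theorem IsNetwork.ae_gain_pos (h : IsNetwork p X g P) : ∀ᵐ ω ∂P, ∀ b : BS, 0 < g b.1 b.2 ω := by
  refine ae_all_iff.2 fun b => ?_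
  have hlaw := expMeasure_Iic_zero 1
  rw [← h.gain_law b.1 b.2, Measure.map_apply (h.gain_measurable _ _) measurableSet_Iic] at hlaw
  simp only [ae_iff, not_lt]
  exact hlaw

theorem IsNetwork.ae_position_ne_zero [IsProbabilityMeasure P] (h : IsNetwork p X g P) :
    ∀ᵐ ω ∂P, ∀ b : BS, X b.1 b.2 ω ≠ 0 := by
  have hall := ae_all_iff.2 fun i => (h.poisson i).ae_ne (x := 0) (by simp)
  filter_upwards [hall] with ω hω b using hω b.1 b.2

theorem IsNetwork.ae_maxSinr_lt_top_and_attained [IsProbabilityMeasure P]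
    (h : IsNetwork p X g P) :
    ∀ᵐ ω ∂P, maxSinr p X g ω < ∞ ∧ ∃ s, sinr p X g s ω = maxSinr p X g ω := by
  filter_upwards [h.ae_gain_pos, h.ae_position_ne_zero] with ω hg hX
  have hα : 0 < p.α := two_pos.trans p.two_lt_α
  refine iSup_sinr_lt_top_and_attained (W := fun b => rxPower p X g b ω)
    (a := fun s => ENNReal.ofReal (p.signalGain s.1))
    (k := fun s b => ENNReal.ofReal (p.coupling s.1 b.1)) (A := ENNReal.ofReal (max p.ζ 1))
    (c := ENNReal.ofReal (min p.υ 1)) (fun b => ?_) (fun b => ?_)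
    (fun s => ENNReal.ofReal_le_ofReal (p.signalGain_le _)) ENNReal.ofReal_ne_top ?_
    (fun s b => ENNReal.ofReal_le_ofReal (p.le_coupling _ _))
  · refine mul_ne_zero (ENNReal.ofReal_pos.2 (mul_pos (p.txPower_pos _) (hg b))).ne' ?_
    simp [ENNReal.rpow_eq_zero_iff, hα.not_gt, hα]
  · refine ENNReal.mul_ne_top ENNReal.ofReal_ne_top ?_
    simp [ENNReal.rpow_eq_top_iff, hα.not_gt, hX b]
  · exact (ENNReal.ofReal_pos.2 (lt_min p.υ_pos one_pos)).ne'

theorem IsNetwork.measurable_rxPower (h : IsNetwork p X g P) (b : BS) :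
    Measurable (rxPower p X g b) := by
  have := (h.poisson b.1).measurable b.2
  have := h.gain_measurable b.1 b.2
  unfold rxPower
  fun_prop

theorem IsNetwork.measurable_sinr (h : IsNetwork p X g P) (s : BS) :
    Measurable (sinr p X g s) := by
  have hW := h.measurable_rxPower
  unfold sinr
  refine ((hW s).const_mul _).div (Measurable.add_const ?_ _)
  exact Measurable.tsum fun b => (hW b.1).const_mul _

theorem IsNetwork.measurable_maxSinr (h : IsNetwork p X g P) : Measurable (maxSinr p X g) :=
  Measurable.iSup h.measurable_sinr

end Network

theorem log2OneAdd_eq_ofReal {x : ℝ≥0∞} (hx : x ≠ ∞) :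
    log2OneAdd x = ENNReal.ofReal (Real.logb 2 (1 + x.toReal)) := by
  have hpos : 0 < 1 + x.toReal := by positivity
  have h1 : 1 + x = ENNReal.ofReal (1 + x.toReal) := by
    rw [ENNReal.ofReal_add zero_le_one ENNReal.toReal_nonneg, ENNReal.ofReal_toReal hx,
      ENNReal.ofReal_one]
  rw [log2OneAdd, h1, ENNReal.log_ofReal_of_pos hpos,
    EReal.toENNReal_of_ne_top (EReal.coe_ne_top _), EReal.toReal_coe, Real.logb,
    ENNReal.ofReal_div_of_pos (Real.log_pos one_lt_two)]

theorem le_logb_one_add_toReal_iff {x : ℝ≥0∞} (hx : x ≠ ∞) (t : ℝ) :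
    t ≤ Real.logb 2 (1 + x.toReal) ↔ ENNReal.ofReal ((2 : ℝ) ^ t - 1) ≤ x := by
  rw [Real.le_logb_iff_rpow_le one_lt_two (by positivity), ENNReal.ofReal_le_iff_le_toReal hx,
    sub_le_iff_le_add']

/-- For `t < 0` this fails at `x = 0`, because `ENNReal.ofReal` truncates the threshold to `0`; the
non-strict version survives truncation. -/
theorem lt_logb_one_add_toReal_iff {x : ℝ≥0∞} (hx : x ≠ ∞) {t : ℝ} (ht : 0 < t) :
    t < Real.logb 2 (1 + x.toReal) ↔ ENNReal.ofReal ((2 : ℝ) ^ t - 1) < x := by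
  rw [Real.lt_logb_iff_rpow_lt one_lt_two (by positivity),
    ENNReal.ofReal_lt_iff_lt_toReal (sub_nonneg.2 (Real.one_le_rpow one_le_two ht.le)) hx,
    sub_lt_iff_lt_add']

section LayerCake

variable {Ω : Type*} [MeasurableSpace Ω] {μ : Measure Ω} {f : Ω → ℝ≥0∞}

theorem logb_one_add_toReal_nonneg (x : ℝ≥0∞) : 0 ≤ Real.logb 2 (1 + x.toReal) :=
  Real.logb_nonneg one_lt_two (le_add_of_nonneg_right ENNReal.toReal_nonneg)

theorem measurable_logb_one_add_toReal (hf : Measurable f) :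
    Measurable fun ω => Real.logb 2 (1 + (f ω).toReal) :=
  (Real.measurable_log.comp (hf.ennreal_toReal.const_add 1)).div_const _

theorem lintegral_log2OneAdd_eq_lintegral_meas_le (hf : Measurable f)
    (hfin : ∀ᵐ ω ∂μ, f ω < ∞) :
    ∫⁻ ω, log2OneAdd (f ω) ∂μ =
      ∫⁻ t in Ioi (0 : ℝ), μ {ω | ENNReal.ofReal ((2 : ℝ) ^ t - 1) ≤ f ω} := by
  rw [lintegral_congr_ae (hfin.mono fun ω hω => log2OneAdd_eq_ofReal hω.ne),
    lintegral_eq_lintegral_meas_le μ (ae_of_all _ fun ω => logb_one_add_toReal_nonneg (f ω))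
      (measurable_logb_one_add_toReal hf).aemeasurable]
  exact lintegral_congr fun t => measure_congr <| Filter.eventuallyEq_set.2 <|
    hfin.mono fun ω hω => le_logb_one_add_toReal_iff hω.ne t

theorem lintegral_log2OneAdd_eq_lintegral_meas_lt (hf : Measurable f)
    (hfin : ∀ᵐ ω ∂μ, f ω < ∞) :
    ∫⁻ ω, log2OneAdd (f ω) ∂μ =
      ∫⁻ t in Ioi (0 : ℝ), μ {ω | ENNReal.ofReal ((2 : ℝ) ^ t - 1) < f ω} := by
  rw [lintegral_congr_ae (hfin.mono fun ω hω => log2OneAdd_eq_ofReal hω.ne),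
    lintegral_eq_lintegral_meas_lt μ (ae_of_all _ fun ω => logb_one_add_toReal_nonneg (f ω))
      (measurable_logb_one_add_toReal hf).aemeasurable]
  exact setLIntegral_congr_fun measurableSet_Ioi fun t ht => measure_congr <|
    Filter.eventuallyEq_set.2 <| hfin.mono fun ω hω => lt_logb_one_add_toReal_iff hω.ne ht

end LayerCake

end FRAN

theorem lemma6 (p : FRAN.Params) {Ω : Type*} [MeasurableSpace Ω] (P : Measure Ω)
    [IsProbabilityMeasure P] (X : FRAN.Tier → ℕ → Ω → FRAN.Plane) (g : FRAN.Tier → ℕ → Ω → ℝ)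
    (hnet : FRAN.IsNetwork p X g P) :
    (∀ᵐ ω ∂P, FRAN.maxSinr p X g ω < ∞ ∧
      ∃ s : FRAN.BS, FRAN.sinr p X g s ω = FRAN.maxSinr p X g ω) ∧
    FRAN.ergodicRate p X g P =
      ∫⁻ t in Ioi (0 : ℝ), P {ω | ENNReal.ofReal ((2 : ℝ) ^ t - 1) ≤ FRAN.maxSinr p X g ω} ∧
    FRAN.ergodicRate p X g P =
      ∫⁻ t in Ioi (0 : ℝ), FRAN.successProb p X g P (fun _ => (2 : ℝ) ^ t - 1) := by
  have hmax := hnet.ae_maxSinr_lt_top_and_attained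
  have hfin : ∀ᵐ ω ∂P, FRAN.maxSinr p X g ω < ∞ := hmax.mono fun _ h => h.1
  have hmeas := hnet.measurable_maxSinr
  refine ⟨hmax, FRAN.lintegral_log2OneAdd_eq_lintegral_meas_le hmeas hfin, ?_⟩
  have hrate := FRAN.lintegral_log2OneAdd_eq_lintegral_meas_lt hmeas hfin
  -- A supremum strictly exceeds a threshold exactly when some term does, so this tail is the
  -- success event.
  simp only [FRAN.maxSinr, lt_iSup_iff] at hrate
  exact hrate
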